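/- **Definitions.** Let $\Sigma=\{0,\dots,q-1\}$. A code is a multiset $\mathcal C$ of words of $\Sigma^n$, and its rate is $\log_q|\mathcal C|/n$, where $|\mathcal C|$ counts multiplicity. A multiset $D$ of words is $(\rho,\ell)$-clustered if there are $Z_1,\dots,Z_n\subseteq\Sigma$ with $|Z_i|\le\ell$ such that $|\{i: x_i\notin Z_i\}|\le\rho n$ for every $x\in D$. A code is $(\rho,\ell,L)$-list-recoverable if it has no $(\rho,\ell)$-clustered sub-multiset of size $L+1$. For $0\le\rho\le1-\ell/q$ put $$h^*_{q,\ell}(\rho)=\rho\log_q\frac{q-\ell}{\rho}+(1-\rho)\log_q\frac{\ell}{1-\rho},$$ where the first term is $0$ if $\rho=0$. For a matrix $\Pi$ in $\mathcal S_\Sigma^{k\times n}$ ($\mathcal S_\Sigma$ being the permutations of $\Sigma$) and $z\in\mathbb F_2^k$ let $y^0=(0,\dots,0)$, let $y^i=y^{i-1}$ if $z_i=0$ and $y^i=(\Pi_{i,1}(y^{i-1}_1),\dots,\Pi_{i,n}(y^{i-1}_n))$ if $z_i=1$, and let $\mathrm{Enc}_\Pi(z)=y^k$. The alphabet-permutation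 (AP) code $\mathcal C_\Pi$ is the multiset of all $\mathrm{Enc}_\Pi(z)$, $z\in\mathbb F_2^k$. A distribution on $\mathcal S_\Sigma$ is $\ell$-wise $\delta$-independent if for any distinct $x_1,\dots,x_\ell\in\Sigma$ the law of $(\pi(x_1),\dots,\pi(x_\ell))$ has total variation distance at most $\delta$ from the uniform law on $\ell$-tuples of distinct elements of $\Sigma$. **Theorem.** There are universal constants $c,A>0$ such that the following holds. Let $q,\ell,L,n\ge1$ be integers with $q\ge2$ and $\ell<\min\{q,L\}$, let $0\le\rho\le1-\frac{\ell}{q}$, $\eta\ge\frac{2\log_q(2n/\ln2)}{n}$ and $\delta>0$. Let $$R=1-h^*_{q,\ell}(\rho)-\frac{\log_q\binom q\ell+\frac1n}{L+1}-\eta$$ and assume that $k:=R\cdot n\log_2 q$ is a non-negative integer. Put $\beta=\max\{0,\ \ell\log_2 q+\log_2\frac1\delta\}$. Then there are an integer $0\le b\le A\beta$ and a family $(T_u)_{u\in\{0,1\}^b}$ of permutations of $\Sigma$ such that the law $D$ of $T_u$ for uniformly random $u$ is $\ell$-wise $\delta$-independent, and such that, when $\Pi\in\mathcal S_\Sigma^{k\times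 n}$ has independent entries with law $D$, the random code $\mathcal C_\Pi$ has the following properties: it can be sampled from at most $A\,nk\,\beta$ independent unbiased random bits; it always has rate $R$; and $$\Pr\big[\mathcal C_\Pi\text{ is }(\rho,\ell,L)\text{-list-recoverable}\big]\ \ge\ 1-\sqrt2\,k\,q^{-\eta n/2}-c\,\delta\,n\,k\,q^{4\ell}.$$ -/

import Mathlib

open scoped ENNReal

noncomputable section

namespace APCode

/-! ### Codes and list-recoverability -/

/-- Words of length `n` over the alphabet `{0, …, q - 1}`. -/
abbrev Word (q n : ℕ) : Type := Fin n → Fin q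

/-- A code is a multiset of words (a codeword may have several messages). -/
abbrev Code (q n : ℕ) : Type := Multiset (Word q n)

/-- The rate `log_q |C| / n` of a code, its size being counted with multiplicity. -/
def rate {q n : ℕ} (C : Code q n) : ℝ :=
  Real.logb q (Multiset.card C) / n

/-- `(ρ, ℓ)`-clustered: some lists `Z₁, …, Zₙ` of size at most `ℓ` disagree with each word
in at most `ρ n` positions. -/
def IsClustered {q n : ℕ} (ρ : ℝ) (ℓ : ℕ) (D : Code q n) : Prop :=
  ∃ Z : Fin n → Finset (Fin q), (∀ i, (Z i).card ≤ ℓ) ∧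
    ∀ x ∈ D, ((Finset.univ.filter fun i => x i ∉ Z i).card : ℝ) ≤ ρ * n

/-- `(ρ, ℓ, L)`-list-recoverable: no clustered sub-multiset has `L + 1` elements. -/
def IsListRecoverable {q n : ℕ} (ρ : ℝ) (ℓ L : ℕ) (C : Code q n) : Prop :=
  ∀ D : Code q n, D ≤ C → Multiset.card D = L + 1 → ¬ IsClustered ρ ℓ D

/-- The function `h*_{q,ℓ}`. At `ρ = 0` the first summand is `0`, as usual. -/
def hStar (q ℓ : ℕ) (ρ : ℝ) : ℝ :=
  if ρ ≤ 1 - (ℓ : ℝ) / q then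
    ρ * Real.logb q (((q : ℝ) - ℓ) / ρ) + (1 - ρ) * Real.logb q ((ℓ : ℝ) / (1 - ρ))
  else 1

/-! ### Alphabet-permutation codes -/

/-- `k × n` matrices of permutations of the alphabet. -/
abbrev PermMatrix (q k n : ℕ) : Type := Fin k → Fin n → Equiv.Perm (Fin q)

/-- The encoding function: start from the zero word and, for `i = 1, …, k`, apply the `i`-th
row of permutations coordinatewise if the `i`-th message bit is `1`. -/
def enc {q n : ℕ} [NeZero q] : (k : ℕ) → PermMatrix q k n → (Fin k → ZMod 2) → Word q n
  | 0, _, _ => fun _ => 0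
  | k + 1, P, z =>
    let y := enc k (fun i => P i.castSucc) (fun i => z i.castSucc)
    if z (Fin.last k) = 0 then y else fun j => P (Fin.last k) j (y j)

/-- The alphabet-permutation code of a matrix, with multiplicities. -/
def apCode {q k n : ℕ} [NeZero q] (P : PermMatrix q k n) : Code q n :=
  (Finset.univ : Finset (Fin k → ZMod 2)).val.map (enc k P)

/-- The law of a `k × n` matrix with independent entries distributed according to `D`. -/
def iidMatrix {q : ℕ} (D : PMF (Equiv.Perm (Fin q))) (k n : ℕ) : PMF (PermMatrix q k n) :=
  PMF.ofFintype (fun P => ∏ i, ∏ j, D (P i j)) (by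
    have hD : ∑ p, D p = 1 := by rw [← tsum_fintype (L := .unconditional _)]; exact D.tsum_coe
    have h1 : ∑ r : Fin n → Equiv.Perm (Fin q), ∏ j, D (r j) = 1 := by
      rw [← Fintype.prod_sum (fun _ p => D p)]; simp [hD]
    rw [← Fintype.prod_sum (fun _ (r : Fin n → Equiv.Perm (Fin q)) => ∏ j, D (r j))]
    simp [h1])

/-- The `D`-random alphabet-permutation code. -/
def randomAPCode {q : ℕ} [NeZero q] (D : PMF (Equiv.Perm (Fin q))) (k n : ℕ) :
    PMF (Code q n) :=
  (iidMatrix D k n).map apCode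

/-! ### Near independence and randomness -/

/-- Total variation distance of distributions on a finite set. -/
def tvDist {Ω : Type*} [Fintype Ω] (P Q : PMF Ω) : ℝ :=
  (1 / 2) * ∑ ω, |(P ω).toReal - (Q ω).toReal|

/-- `m`-wise `δ`-independence of a distribution on permutations; tuples of `m` distinct
symbols are embeddings `Fin m ↪ Fin q`. -/
def IsNearIndependent {q : ℕ} (m : ℕ) (δ : ℝ) (D : PMF (Equiv.Perm (Fin q))) : Prop :=
  ∀ x : Fin m ↪ Fin q,
    haveI : Nonempty (Fin m ↪ Fin q) := ⟨x⟩
    tvDist (D.map fun p => x.trans p.toEmbedding) (PMF.uniformOfFintype (Fin m ↪ Fin q)) ≤ δ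

/-- The law of `g(u)` for `r` independent unbiased random bits `u`. -/
def fromBits {α : Type*} {r : ℕ} (g : (Fin r → Bool) → α) : PMF α :=
  (PMF.uniformOfFintype (Fin r → Bool)).map g

/-- The distribution `P` can be sampled exactly from `r` independent unbiased random bits. -/
def UsesRandomBits {α : Type*} (P : PMF α) (r : ℕ) : Prop :=
  ∃ g : (Fin r → Bool) → α, P = fromBits g

end APCode

end

/-!
Fix `a > 1` and let `φᵢ` be the mean, over all `n`-tuples `Z` of `ℓ`-subsets of the alphabet, of
`a ^ Nᵢ(Z) - 1`, where `Nᵢ(Z)` counts the messages whose codeword after `i` rows misses at most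
`ρ n` of the lists `Z`. As soon as `a ^ (L + 1)` exceeds the number of tuples, `φₖ < 1` forces
list-recoverability. A further row turns `φ` into `2 φ + c`, where `c` correlates `a ^ Nᵢ - 1` with
its translate by the row; a nearly independent permutation moves an `ℓ`-set to a nearly uniform one,
so the mean of `c` is at most about `φ²`. Markov's inequality for `c` then shows that `φ ≤ s²` is
followed by `φ ≤ 2 s² + s³` except with probability about `s`, and these losses are summed over
the rows. The value of `φ₀` is a Chernoff bound with exponent `h*`.

The small family of permutations is chosen greedily. Relative to the uniform law each permutation
has a deviation vector, and these vectors sum to zero over the symmetric group, so the next one can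
be chosen to make no acute angle with the sum so far: the squared norms add up.
-/

noncomputable section

namespace APCode

open Finset
open scoped BigOperators Pointwise

section FiniteLaws

variable {α β : Type*}

/-- The probability of the event `S` under the law `D`, as a real number. -/
def prob (D : PMF α) (S : Set α) : ℝ := (D.toOuterMeasure S).toReal

/-- The expectation of `f` under a law `D` on a finite type. -/
def expectation [Fintype α] (D : PMF α) (f : α → ℝ) : ℝ := ∑ x, (D x).toReal * f x

lemma prob_map (D : PMF α) (g : α → β) (S : Set β) : prob (D.map g) S = prob D (g ⁻¹' S) := by
  rw [prob, PMF.toOuterMeasure_map_apply, prob]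

lemma prob_eq_one_of_forall {S : Set α} (D : PMF α) (h : ∀ x, x ∈ S) : prob D S = 1 := by
  rw [prob, (D.toOuterMeasure_apply_eq_one_iff S).2 fun x _ => h x, ENNReal.toReal_one]

lemma prob_nonneg (D : PMF α) (S : Set α) : 0 ≤ prob D S := ENNReal.toReal_nonneg

lemma prob_eq_measureReal (D : PMF α) (S : Set α) : prob D S = (@PMF.toMeasure α ⊤ D).real S := by
  rw [prob, MeasureTheory.measureReal_def,
    @PMF.toMeasure_apply_eq_toOuterMeasure_apply α ⊤ D S trivial]

lemma prob_mono (D : PMF α) {S T : Set α} (h : S ⊆ T) : prob D S ≤ prob D T := by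
  let : MeasurableSpace α := ⊤
  rw [prob_eq_measureReal, prob_eq_measureReal]
  exact MeasureTheory.measureReal_mono h

lemma prob_compl (D : PMF α) (S : Set α) : prob D Sᶜ = 1 - prob D S := by
  let : MeasurableSpace α := ⊤
  rw [prob_eq_measureReal, prob_eq_measureReal,
    MeasureTheory.probReal_compl_eq_one_sub .of_discrete]

variable [Fintype α]

lemma prob_eq_expectation (D : PMF α) (S : Set α) : prob D S = expectation D (S.indicator 1) := by
  classical
  rw [prob, PMF.toOuterMeasure_apply_fintype,
    ENNReal.toReal_sum fun x _ => ne_top_of_le_ne_top (D.apply_ne_top x) (Set.indicator_le_self ..)]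
  refine Finset.sum_congr rfl fun x _ => ?_
  by_cases hx : x ∈ S <;> simp [hx]

lemma sum_toReal_eq_one (D : PMF α) : ∑ x, (D x).toReal = 1 := by
  rw [← ENNReal.toReal_sum fun x _ => D.apply_ne_top x, ← tsum_fintype (L := .unconditional _),
    D.tsum_coe, ENNReal.toReal_one]

lemma expectation_const (D : PMF α) (c : ℝ) : expectation D (fun _ => c) = c := by
  rw [expectation, ← Finset.sum_mul, sum_toReal_eq_one, one_mul]

lemma expectation_mono (D : PMF α) {f g : α → ℝ} (h : ∀ x, f x ≤ g x) :
    expectation D f ≤ expectation D g :=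
  Finset.sum_le_sum fun x _ => mul_le_mul_of_nonneg_left (h x) ENNReal.toReal_nonneg

lemma expectation_add (D : PMF α) (f g : α → ℝ) :
    expectation D (fun x => f x + g x) = expectation D f + expectation D g := by
  simp only [expectation, mul_add, Finset.sum_add_distrib]

lemma expectation_mul_const (D : PMF α) (f : α → ℝ) (c : ℝ) :
    expectation D (fun x => f x * c) = expectation D f * c := by
  simp only [expectation, Finset.sum_mul, mul_assoc]

lemma prob_lt_le_expectation_div (D : PMF α) {f : α → ℝ} (hf : ∀ x, 0 ≤ f x) {t : ℝ}
    (ht : 0 < t) : prob D {x | t < f x} ≤ expectation D f / t := by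
  rw [le_div_iff₀ ht, prob_eq_expectation, ← expectation_mul_const]
  refine expectation_mono D fun x => ?_
  by_cases hx : t < f x
  · simpa [Set.indicator, hx] using hx.le
  · simpa [Set.indicator, hx] using hf x

lemma prob_le_prob_add_tvDist (P Q : PMF α) (S : Set α) : prob P S ≤ prob Q S + tvDist P Q := by
  have h : prob P S - prob P Sᶜ - (prob Q S - prob Q Sᶜ) ≤
      ∑ x, |(P x).toReal - (Q x).toReal| := by
    simp only [prob_eq_expectation, expectation, ← Finset.sum_sub_distrib]
    refine Finset.sum_le_sum fun x _ => ?_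
    by_cases hx : x ∈ S
    · simpa [hx] using le_abs_self ((P x).toReal - (Q x).toReal)
    · simpa [hx, add_comm] using neg_le_abs ((P x).toReal - (Q x).toReal)
  rw [prob_compl, prob_compl] at h
  rw [tvDist]
  linarith

end FiniteLaws

section IndependentFamilies

variable {α β : Type*} {ι : Type*} [Fintype ι] [DecidableEq ι] [Fintype α]

variable (ι) in
/-- The law of a family, indexed by `ι`, of independent elements with law `D`. -/
def iid (D : PMF α) : PMF (ι → α) :=
  PMF.ofFintype (fun x => ∏ i, D (x i)) <| by
    rw [← Fintype.prod_sum fun _ a => D a, ← tsum_fintype (L := .unconditional _), D.tsum_coe,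
      Finset.prod_const_one]

lemma iidMatrix_eq_iid {q : ℕ} (D : PMF (Equiv.Perm (Fin q))) (k n : ℕ) :
    iidMatrix D k n = iid (Fin k) (iid (Fin n) D) := rfl

lemma iid_apply (D : PMF α) (x : ι → α) : iid ι D x = ∏ i, D (x i) := rfl

lemma iid_map [Fintype β] (D : PMF α) (g : α → β) :
    iid ι (D.map g) = (iid ι D).map fun x i => g (x i) := by
  classical
  ext y
  simp only [iid_apply, PMF.map_apply, tsum_fintype]
  rw [Fintype.prod_sum fun i a => if y i = g a then D a else 0]
  refine Finset.sum_congr rfl fun x _ => ?_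
  rw [Finset.prod_ite_zero]
  simp only [Finset.mem_univ, true_implies, funext_iff]

lemma iid_uniformOfFintype [Nonempty α] :
    iid ι (PMF.uniformOfFintype α) = PMF.uniformOfFintype (ι → α) := by
  ext x
  simp [iid_apply, ENNReal.inv_pow]

lemma prob_iid_pi (D : PMF α) (S : ι → Set α) :
    prob (iid ι D) (Set.univ.pi S) = ∏ i, prob D (S i) := by
  simp only [prob_eq_expectation, expectation]
  rw [Fintype.prod_sum fun i a => (D a).toReal * (S i).indicator 1 a]
  refine Finset.sum_congr rfl fun x _ => ?_
  rw [Finset.prod_mul_distrib, iid_apply, ENNReal.toReal_prod]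
  congr 1
  classical
  simp only [Set.indicator_apply, Set.mem_univ_pi, Pi.one_apply, Finset.prod_ite_zero,
    Finset.prod_const_one, Finset.mem_univ, true_implies]

lemma expectation_iid_succ (D : PMF α) {k : ℕ} (f : (Fin (k + 1) → α) → ℝ) :
    expectation (iid (Fin (k + 1)) D) f =
      expectation (iid (Fin k) D) fun x =>
        expectation D fun a => f (Fin.snoc x a) := by
  simp only [expectation, Finset.mul_sum]
  rw [← (Fin.snocEquiv fun _ => α).sum_comp, Fintype.sum_prod_type, Finset.sum_comm]
  refine Finset.sum_congr rfl fun x _ => Finset.sum_congr rfl fun a _ => ?_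
  simp only [iid_apply, Fin.snocEquiv_apply, Fin.prod_univ_castSucc, Fin.snoc_castSucc,
    Fin.snoc_last, ENNReal.toReal_mul]
  exact mul_assoc ..

lemma prob_iid_succ (D : PMF α) {k : ℕ} (S : Set (Fin (k + 1) → α)) :
    prob (iid (Fin (k + 1)) D) S =
      expectation (iid (Fin k) D) fun x => prob D {a | Fin.snoc x a ∈ S} := by
  simp only [prob_eq_expectation, expectation_iid_succ]
  rfl

end IndependentFamilies

section RandomBitsAndRate

variable {α β : Type*} {r q k n : ℕ} [NeZero q]

lemma UsesRandomBits.map {P : PMF α} (hP : UsesRandomBits P r) (f : α → β) :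
    UsesRandomBits (P.map f) r := by
  obtain ⟨g, rfl⟩ := hP
  exact ⟨f ∘ g, PMF.map_comp ..⟩

lemma map_uniformOfFintype_equiv [Fintype α] [Nonempty α] [Fintype β] [Nonempty β] (e : α ≃ β) :
    (PMF.uniformOfFintype α).map e = PMF.uniformOfFintype β := by
  classical
  ext y
  simp [PMF.map_apply, tsum_fintype, ← e.symm_apply_eq, Fintype.card_congr e]

lemma UsesRandomBits.iid [Fintype α] {P : PMF α} (hP : UsesRandomBits P r) (n : ℕ) :
    UsesRandomBits (iid (Fin n) P) (n * r) := by
  obtain ⟨g, rfl⟩ := hP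
  let e : (Fin (n * r) → Bool) ≃ (Fin n → Fin r → Bool) :=
    (finProdFinEquiv.symm.arrowCongr (Equiv.refl Bool)).trans (Equiv.curry ..)
  refine ⟨(fun x i => g (x i)) ∘ e, ?_⟩
  rw [fromBits, fromBits, iid_map, iid_uniformOfFintype, ← PMF.map_comp,
    map_uniformOfFintype_equiv]

lemma usesRandomBits_randomAPCode {D : PMF (Equiv.Perm (Fin q))} (hD : UsesRandomBits D r)
    (k n : ℕ) : UsesRandomBits (randomAPCode D k n) (k * (n * r)) :=
  ((hD.iid n).iid k).map apCode

lemma card_apCode (P : PermMatrix q k n) : Multiset.card (apCode P) = 2 ^ k := by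
  simp [apCode, ZMod.card]

lemma rate_apCode {R : ℝ} (hq : 1 < q) (hn : n ≠ 0) (hk : (k : ℝ) = R * Real.logb 2 q * n)
    (P : PermMatrix q k n) : rate (apCode P) = R := by
  have hq' : Real.log q ≠ 0 := (Real.log_pos (by exact_mod_cast hq)).ne'
  have h2 : Real.log 2 ≠ 0 := (Real.log_pos one_lt_two).ne'
  rw [rate, card_apCode, Nat.cast_pow, Nat.cast_ofNat, Real.logb_pow, hk, Real.logb, Real.logb]
  field_simp

end RandomBitsAndRate

section TransitiveActions

variable {G X Y : Type*} [Group G] [MulAction G X] [MulAction G Y] [Fintype X] [Fintype Y]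
  [DecidableEq Y] [MulAction.IsPretransitive G Y]

lemma card_fiber_mul_card (f : X →[G] Y) (y : Y) :
    #{x | f x = y} * Fintype.card Y = Fintype.card X := by
  have h (y' : Y) : #{x | f x = y'} = #{x | f x = y} := by
    obtain ⟨g, rfl⟩ := MulAction.exists_smul_eq G y' y
    exact card_equiv (MulAction.toPerm g) fun x => by simp
  have hX := card_eq_sum_card_fiberwise (s := univ) fun x _ => mem_coe.2 (mem_univ (f x))
  simp only [h, sum_const, smul_eq_mul, card_univ] at hX
  rw [hX, mul_comm]

lemma card_smul_eq_mul_card [Fintype G] (x y : Y) :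
    #{g : G | g • x = y} * Fintype.card Y = Fintype.card G :=
  card_fiber_mul_card (⟨fun g => g • x, fun a b => mul_smul a b x⟩ : G →[G] Y) y

end TransitiveActions

section SmallFamilies

variable {G U : Type*}

lemma exists_norm_sum_sq_le {E : Type*} [NormedAddCommGroup E] [InnerProductSpace ℝ E] [Fintype G]
    [Nonempty G] {a : G → E} {V : ℝ} (ha : ∑ g, a g = 0) (hV : ∀ g, ‖a g‖ ^ 2 ≤ V) (S : Finset U) :
    ∃ f : U → G, ‖∑ u ∈ S, a (f u)‖ ^ 2 ≤ #S * V := by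
  classical
  induction S using Finset.induction with
  | empty => exact ⟨fun _ => Classical.arbitrary G, by simp⟩
  | insert u S hu ih =>
    obtain ⟨f, hf⟩ := ih
    obtain ⟨g, -, hg⟩ : ∃ g ∈ univ, inner ℝ (a g) (∑ v ∈ S, a (f v)) ≤ 0 :=
      exists_le_of_sum_le univ_nonempty (by rw [← sum_inner, ha]; simp)
    refine ⟨Function.update f u g, ?_⟩
    have hS : ∑ v ∈ S, a (Function.update f u g v) = ∑ v ∈ S, a (f v) :=
      sum_congr rfl fun v hv => by rw [Function.update_of_ne (ne_of_mem_of_not_mem hv hu)]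
    rw [sum_insert hu, Function.update_self, hS, norm_add_sq_real, card_insert_of_notMem hu]
    push_cast
    linarith [hV g]

variable {X : Type*} [DecidableEq X]

lemma toReal_map_uniformOfFintype [Fintype U] [Nonempty U] (g : U → X) (y : X) :
    ((PMF.uniformOfFintype U).map g y).toReal = #{u | g u = y} / Fintype.card U := by
  simp [PMF.map_apply, tsum_fintype, eq_comm (a := y), ← sum_filter, div_eq_mul_inv]

variable [Fintype X]

lemma exists_sum_sq_card_smul_eq_le [Group G] [Finite G] [MulAction G X]
    [MulAction.IsPretransitive G X] [Fintype U] :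
    ∃ f : U → G, ∑ x : X, ∑ y : X,
      ((#{u | f u • x = y} : ℝ) - Fintype.card U / Fintype.card X) ^ 2 ≤
        Fintype.card U * Fintype.card X := by
  have := Fintype.ofFinite G
  let a (g : G) : EuclideanSpace ℝ (X × X) :=
    WithLp.toLp 2 fun z => (if g • z.1 = z.2 then 1 else 0) - (Fintype.card X : ℝ)⁻¹
  have hX (x : X) : (Fintype.card X : ℝ) ≠ 0 := by
    have : Nonempty X := ⟨x⟩
    exact_mod_cast Fintype.card_ne_zero
  have ha : ∑ g, a g = 0 := by
    ext ⟨x, y⟩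
    have h : (#{g : G | g • x = y} : ℝ) * Fintype.card X = Fintype.card G := by
      exact_mod_cast card_smul_eq_mul_card (G := G) x y
    simp [a, sum_sub_distrib, ← h, hX x]
  have hV (g : G) : ‖a g‖ ^ 2 ≤ Fintype.card X := by
    rw [EuclideanSpace.real_norm_sq_eq, Fintype.sum_prod_type, ← card_univ, ← nsmul_one,
      ← sum_const]
    refine sum_le_sum fun x _ => ?_
    simp only [a, sub_sq, ite_pow, sum_add_distrib, sum_sub_distrib,
      ← sum_mul, ← mul_sum]
    have hc : (0 : ℝ) ≤ (Fintype.card X : ℝ)⁻¹ := by positivity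
    simp only [sq, mul_zero, sum_ite_eq, mem_univ, ↓reduceIte, mul_one, sum_const,
      card_univ, nsmul_eq_mul, ne_eq, hX x, not_false_eq_true, mul_inv_cancel_left₀]
    linarith
  obtain ⟨f, hf⟩ := exists_norm_sum_sq_le ha hV (univ : Finset U)
  refine ⟨f, ?_⟩
  rw [EuclideanSpace.real_norm_sq_eq, Fintype.sum_prod_type, card_univ] at hf
  refine le_of_eq_of_le ?_ hf
  refine sum_congr rfl fun x _ => sum_congr rfl fun y _ => ?_
  simp [a, sum_boole, div_eq_mul_inv]

lemma tvDist_map_uniformOfFintype_le [Fintype U] [Nonempty U] [Nonempty X] (g : U → X) {δ : ℝ}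
    (hδ : 0 ≤ δ) (hU : (Fintype.card X : ℝ) ^ 2 ≤ 4 * δ ^ 2 * Fintype.card U)
    (hg : ∑ y : X, ((#{u | g u = y} : ℝ) - Fintype.card U / Fintype.card X) ^ 2 ≤
        Fintype.card U * Fintype.card X) :
    tvDist ((PMF.uniformOfFintype U).map g) (PMF.uniformOfFintype X) ≤ δ := by
  have : (0 : ℝ) < Fintype.card X := by exact_mod_cast Fintype.card_pos
  have hU0 : (0 : ℝ) < Fintype.card U := by exact_mod_cast Fintype.card_pos
  have hcs := sq_sum_le_card_mul_sum_sq (s := univ)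
    (f := fun y : X => |(#{u | g u = y} : ℝ) - Fintype.card U / Fintype.card X|)
  simp only [sq_abs, card_univ] at hcs
  have hsum : ∑ y : X, |(#{u | g u = y} : ℝ) - Fintype.card U / Fintype.card X| ≤
      2 * δ * Fintype.card U := by
    refine le_of_sq_le_sq (hcs.trans ?_) (by positivity)
    nlinarith
  have hterm (y : X) : |((PMF.uniformOfFintype U).map g y).toReal -
      (PMF.uniformOfFintype X y).toReal| =
        |(#{u | g u = y} : ℝ) - Fintype.card U / Fintype.card X| / Fintype.card U := by
    rw [toReal_map_uniformOfFintype, PMF.uniformOfFintype_apply, ENNReal.toReal_inv,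
      ENNReal.toReal_natCast, ← abs_of_pos hU0, ← abs_div, abs_of_pos hU0]
    congr 1
    field_simp
  rw [tvDist, sum_congr rfl fun y _ => hterm y, ← sum_div, ← mul_div_assoc, div_le_iff₀ hU0]
  linarith

lemma exists_isNearIndependent {q m b : ℕ} {δ : ℝ} (hδ : 0 ≤ δ)
    (hb : ((q : ℝ) ^ m) ^ 2 ≤ 4 * δ ^ 2 * 2 ^ b) :
    ∃ T : (Fin b → Bool) → Equiv.Perm (Fin q), IsNearIndependent m δ (fromBits T) := by
  classical
  have := Equiv.Perm.isMultiplyPretransitive (Fin q) m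
  obtain ⟨T, hT⟩ := exists_sum_sq_card_smul_eq_le (G := Equiv.Perm (Fin q)) (U := Fin b → Bool)
    (X := Fin m ↪ Fin q)
  refine ⟨T, fun x => ?_⟩
  have : Nonempty (Fin m ↪ Fin q) := ⟨x⟩
  rw [fromBits, PMF.map_comp]
  refine tvDist_map_uniformOfFintype_le _ hδ ?_ <|
    (single_le_sum (fun _ _ => sum_nonneg fun _ _ => sq_nonneg _) (mem_univ x)).trans hT
  have hcard : (Fintype.card (Fin m ↪ Fin q) : ℝ) ≤ (q : ℝ) ^ m := by
    rw [Fintype.card_embedding_eq, Fintype.card_fin, Fintype.card_fin]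
    exact_mod_cast Nat.descFactorial_le_pow q m
  calc (Fintype.card (Fin m ↪ Fin q) : ℝ) ^ 2 ≤ ((q : ℝ) ^ m) ^ 2 := by gcongr
    _ ≤ 4 * δ ^ 2 * Fintype.card (Fin b → Bool) := by simpa using hb

lemma exists_isNearIndependent_le {q m : ℕ} (hq : 0 < q) {δ : ℝ} (hδ : 0 < δ) :
    ∃ (b : ℕ) (T : (Fin b → Bool) → Equiv.Perm (Fin q)),
      (b : ℝ) ≤ 2 * max 0 (m * Real.logb 2 q + Real.logb 2 (1 / δ)) ∧
        IsNearIndependent m δ (fromBits T) := by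
  have : (0 : ℝ) < q := by exact_mod_cast hq
  set β : ℝ := m * Real.logb 2 q + Real.logb 2 (1 / δ) with hβ
  have hpow : (2 : ℝ) ^ (2 * β - 2) = ((q : ℝ) ^ m) ^ 2 / (4 * δ ^ 2) := by
    have h : (2 : ℝ) ^ β = (q : ℝ) ^ m / δ := by
      rw [hβ, ← Real.logb_pow, ← Real.logb_mul (by positivity) (by positivity), mul_one_div,
        Real.rpow_logb two_pos (by norm_num) (by positivity)]
    rw [Real.rpow_sub two_pos, mul_comm 2 β, Real.rpow_mul zero_le_two, h, Real.rpow_two,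
      Real.rpow_two]
    field_simp
    norm_num
  obtain ⟨T, hT⟩ := exists_isNearIndependent (q := q) (m := m) (b := ⌈2 * β - 2⌉₊) hδ.le <| by
    rw [← div_le_iff₀' (by positivity), ← hpow, ← Real.rpow_natCast]
    exact Real.rpow_le_rpow_of_exponent_le one_le_two (Nat.le_ceil _)
  refine ⟨_, T, ?_, hT⟩
  rcases le_total (2 * β - 2) 0 with h | h
  · simp [Nat.ceil_eq_zero.2 h]
  · linarith [Nat.ceil_lt_add_one h, le_max_right 0 β]

end SmallFamilies

section Spread

variable {G : Type*} {K : ℝ} {D : PMF G}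

/-- A random element of `G` with law `D` moves every point of `X` to any given point with
probability at most `K / |X|`, that is, `K` times the probability for a uniform target. -/
def IsSpread (K : ℝ) (D : PMF G) (X : Type*) [Fintype X] [SMul G X] : Prop :=
  ∀ x y : X, prob D {g | g • x = y} ≤ K / Fintype.card X

variable {X : Type*} [Fintype X] [SMul G X] [Fintype G]

lemma IsSpread.iid (hD : IsSpread K D X) (ι : Type*) [Fintype ι]
    [DecidableEq ι] : IsSpread (K ^ Fintype.card ι) (iid ι D) (ι → X) := by
  intro x y
  have h : {g : ι → G | g • x = y} = Set.univ.pi fun i => {a | a • x i = y i} := by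
    ext g
    simp [funext_iff]
  rw [h, prob_iid_pi]
  calc ∏ i, prob D {a | a • x i = y i} ≤ ∏ _i : ι, K / Fintype.card X :=
        prod_le_prod (fun _ _ => prob_nonneg ..) fun i _ => hD (x i) (y i)
    _ = K ^ Fintype.card ι / Fintype.card (ι → X) := by simp

lemma IsSpread.expectation_expect_mul_le (hD : IsSpread K D X) {u : X → ℝ}
    (hu : ∀ x, 0 ≤ u x) :
    expectation D (fun g => 𝔼 x, u (g • x) * u x) ≤ K * (𝔼 x, u x) ^ 2 := by
  classical
  have h (g : G) : ∑ x, u (g • x) * u x =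
      ∑ x, ∑ y, {a | a • x = y}.indicator 1 g * (u y * u x) := by
    simp [Set.indicator_apply]
  calc expectation D (fun g => 𝔼 x, u (g • x) * u x)
      = (∑ x, ∑ y, prob D {g | g • x = y} * (u y * u x)) / Fintype.card X := by
        simp only [Fintype.expect_eq_sum_div_card, h, prob_eq_expectation, expectation, sum_mul,
          mul_sum, ← mul_div_assoc, ← sum_div, mul_assoc]
        rw [sum_comm]
        congr 1
        exact sum_congr rfl fun x _ => sum_comm
    _ ≤ (∑ x, ∑ y, K / Fintype.card X * (u y * u x)) / Fintype.card X := by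
        gcongr with x _ y _
        · exact mul_nonneg (hu y) (hu x)
        · exact hD x y
    _ = K * (𝔼 x, u x) ^ 2 := by
        simp only [Fintype.expect_eq_sum_div_card, ← mul_sum, ← sum_mul]
        ring

end Spread

lemma prob_uniformOfFintype_fiber {G X Y : Type*} [Group G] [MulAction G X] [MulAction G Y]
    [Fintype X] [Nonempty X] [Fintype Y] [MulAction.IsPretransitive G Y] (f : X →[G] Y) (y : Y) :
    prob (PMF.uniformOfFintype X) {x | f x = y} = (Fintype.card Y : ℝ)⁻¹ := by
  classical
  have hY : (Fintype.card Y : ℝ) ≠ 0 := Nat.cast_ne_zero.2 (Fintype.card_pos_iff.2 ⟨y⟩).ne'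
  have hX : (Fintype.card X : ℝ) ≠ 0 := Nat.cast_ne_zero.2 Fintype.card_ne_zero
  have h : (#{x | f x = y} : ℝ) * Fintype.card Y = Fintype.card X := by
    exact_mod_cast card_fiber_mul_card f y
  have hcard : Fintype.card {x | f x = y} = #{x | f x = y} := Fintype.card_subtype _
  rw [prob, PMF.toOuterMeasure_uniformOfFintype_apply, ENNReal.toReal_div, ENNReal.toReal_natCast,
    ENNReal.toReal_natCast, hcard, div_eq_iff hX, ← h]
  field_simp

lemma IsNearIndependent.isSpread {q ℓ : ℕ} {δ : ℝ} {D : PMF (Equiv.Perm (Fin q))}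
    (hD : IsNearIndependent ℓ δ D) :
    IsSpread (1 + δ * q.choose ℓ) D (Set.powersetCard (Fin q) ℓ) := by
  intro s t
  let F := Set.powersetCard.mulActionHom_of_embedding (Equiv.Perm (Fin q)) (Fin q) ℓ
  have := Set.powersetCard.isPretransitive (α := Fin q) (n := ℓ)
  obtain ⟨x, rfl⟩ : ∃ x, F x = s :=
    Set.powersetCard.mulActionHom_of_embedding_surjective (Equiv.Perm (Fin q)) (Fin q) s
  have : Nonempty (Fin ℓ ↪ Fin q) := ⟨x⟩
  have hcard : Fintype.card (Set.powersetCard (Fin q) ℓ) = q.choose ℓ := by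
    rw [← Nat.card_eq_fintype_card, Set.powersetCard.card, Nat.card_fin]
  have hpos : (q.choose ℓ : ℝ) ≠ 0 := by
    rw [← hcard]
    exact Nat.cast_ne_zero.2 (Fintype.card_pos_iff.2 ⟨t⟩).ne'
  have hset : {p : Equiv.Perm (Fin q) | p • F x = t} =
      (fun p => x.trans p.toEmbedding) ⁻¹' {y | F y = t} := by
    ext p
    exact iff_of_eq (congrArg (· = t) (map_smul F p x).symm)
  calc prob D {p | p • F x = t} = prob (D.map fun p => x.trans p.toEmbedding) {y | F y = t} := by
        rw [hset, prob_map]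
    _ ≤ prob (PMF.uniformOfFintype (Fin ℓ ↪ Fin q)) {y | F y = t} + δ :=
        (prob_le_prob_add_tvDist ..).trans (by gcongr; exact hD x)
    _ = (1 + δ * q.choose ℓ) / Fintype.card (Set.powersetCard (Fin q) ℓ) := by
        rw [prob_uniformOfFintype_fiber, hcard]
        field_simp

section Misses

variable {ι α : Type*} [Fintype ι] [DecidableEq α] {ℓ : ℕ}

/-- The number of coordinates of the word `x` that lie outside the lists `Z`. -/
def misses (x : ι → α) (Z : ι → Set.powersetCard α ℓ) : ℕ :=
  #{i | x i ∉ (Z i : Finset α)}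

lemma misses_smul {G : Type*} [Group G] [MulAction G α] (g : ι → G) (x : ι → α)
    (Z : ι → Set.powersetCard α ℓ) : misses (g • x) (g • Z) = misses x Z := by
  simp only [misses, Pi.smul_apply', Set.powersetCard.coe_smul, smul_mem_smul_finset_iff]

end Misses

section Potential

variable {q k n ℓ : ℕ} [NeZero q] {ρ a : ℝ}

/-- The number of messages whose codeword misses at most `ρ n` of the lists `Z`. -/
def closeCount (ρ : ℝ) (P : PermMatrix q k n) (Z : Fin n → Set.powersetCard (Fin q) ℓ) : ℕ :=
  #{z | (misses (enc k P z) Z : ℝ) ≤ ρ * n}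

/-- The exponential moment `a ^ closeCount`, normalised to vanish when no codeword is close. -/
def excess (ρ a : ℝ) (P : PermMatrix q k n) (Z : Fin n → Set.powersetCard (Fin q) ℓ) : ℝ :=
  a ^ closeCount ρ P Z - 1

/-- The mean excess over all tuples of lists of size `ℓ`: the quantity that is tracked while the
rows of the matrix are revealed one at a time. -/
def potential (ℓ : ℕ) (ρ a : ℝ) (P : PermMatrix q k n) : ℝ :=
  𝔼 Z : Fin n → Set.powersetCard (Fin q) ℓ, excess ρ a P Z

lemma enc_snoc (P : PermMatrix q k n) (g : Fin n → Equiv.Perm (Fin q)) (z : Fin k → ZMod 2)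
    (c : ZMod 2) :
    enc (k + 1) (Fin.snoc P g) (Fin.snoc z c : Fin (k + 1) → ZMod 2) =
      if c = 0 then enc k P z else g • enc k P z := by
  simp only [enc, Fin.snoc_castSucc, Fin.snoc_last]
  rfl

lemma closeCount_snoc (P : PermMatrix q k n) (g : Fin n → Equiv.Perm (Fin q))
    (Z : Fin n → Set.powersetCard (Fin q) ℓ) :
    closeCount ρ (Fin.snoc P g) Z =
      closeCount ρ P Z + closeCount ρ P (g⁻¹ • Z) := by
  have hZ (z : Fin k → ZMod 2) : misses (g • enc k P z) Z = misses (enc k P z) (g⁻¹ • Z) := by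
    rw [← misses_smul g (enc k P z), smul_inv_smul]
  simp only [closeCount, card_filter]
  rw [← (Fin.snocEquiv fun _ : Fin (k + 1) => ZMod 2).sum_comp, Fintype.sum_prod_type,
    show (univ : Finset (ZMod 2)) = {0, 1} from rfl, sum_pair zero_ne_one]
  have hmsg (c : ZMod 2) (z : Fin k → ZMod 2) :
      Fin.snocEquiv (fun _ : Fin (k + 1) => ZMod 2) (c, z) = Fin.snoc z c := rfl
  simp [hmsg, enc_snoc, hZ]

lemma excess_nonneg (ha : 1 ≤ a) (P : PermMatrix q k n) (Z : Fin n → Set.powersetCard (Fin q) ℓ) :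
    0 ≤ excess ρ a P Z :=
  sub_nonneg.2 (one_le_pow₀ ha)

lemma excess_snoc (P : PermMatrix q k n) (g : Fin n → Equiv.Perm (Fin q))
    (Z : Fin n → Set.powersetCard (Fin q) ℓ) :
    excess ρ a (Fin.snoc P g) Z =
      excess ρ a P Z + excess ρ a P (g⁻¹ • Z) + excess ρ a P Z * excess ρ a P (g⁻¹ • Z) := by
  rw [excess, closeCount_snoc, pow_add, excess, excess]
  ring

lemma potential_snoc (P : PermMatrix q k n) (g : Fin n → Equiv.Perm (Fin q)) :
    potential ℓ ρ a (Fin.snoc P g) =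
      2 * potential ℓ ρ a P +
        𝔼 Z : Fin n → Set.powersetCard (Fin q) ℓ, excess ρ a P (g • Z) * excess ρ a P Z := by
  have hmul : 𝔼 Z : Fin n → Set.powersetCard (Fin q) ℓ,
      excess ρ a P Z * excess ρ a P (g⁻¹ • Z) =
        𝔼 Z : Fin n → Set.powersetCard (Fin q) ℓ, excess ρ a P (g • Z) * excess ρ a P Z :=
    (Fintype.expect_equiv (MulAction.toPerm g) _ _ fun Z => by simp).symm
  have hinv : 𝔼 Z : Fin n → Set.powersetCard (Fin q) ℓ, excess ρ a P (g⁻¹ • Z) =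
      potential ℓ ρ a P :=
    Fintype.expect_equiv (MulAction.toPerm g⁻¹) _ _ fun Z => rfl
  simp only [potential, excess_snoc, expect_add_distrib, hmul]
  rw [hinv, potential]
  ring

lemma isListRecoverable_of_potential_lt_one {L : ℕ} (hℓ : ℓ ≤ q) (ha : 1 ≤ a)
    (haL : (q.choose ℓ : ℝ) ^ n + 1 ≤ a ^ (L + 1)) {P : PermMatrix q k n}
    (hP : potential ℓ ρ a P < 1) : IsListRecoverable ρ ℓ L (apCode P) := by
  rintro D hD hcard ⟨Z, hZ, hclose⟩
  have hsup (i) : ∃ t : Finset (Fin q), Z i ⊆ t ∧ #t = ℓ :=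
    exists_superset_card_eq (hZ i) (by simpa using hℓ)
  choose t hZt ht using hsup
  let Y : Fin n → Set.powersetCard (Fin q) ℓ := fun i => ⟨t i, ht i⟩
  have hY : L + 1 ≤ closeCount ρ P Y := by
    have hle : D ≤ (apCode P).filter fun x => (misses x Y : ℝ) ≤ ρ * n := by
      refine Multiset.le_filter.2 ⟨hD, fun x hx => le_trans ?_ (hclose x hx)⟩
      exact Nat.cast_le.2 (card_le_card <| monotone_filter_right _ fun i _ hi hm => hi (hZt i hm))
    have := Multiset.card_le_card hle
    rwa [hcard, apCode, Multiset.filter_map, Multiset.card_map] at this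
  have hN : (Fintype.card (Fin n → Set.powersetCard (Fin q) ℓ) : ℝ) = (q.choose ℓ : ℝ) ^ n := by
    rw [Fintype.card_fun, ← Nat.card_eq_fintype_card, Set.powersetCard.card]
    simp
  have hpos : (0 : ℝ) < (q.choose ℓ : ℝ) ^ n :=
    pow_pos (by exact_mod_cast Nat.choose_pos hℓ) n
  refine hP.not_ge ?_
  rw [potential, Fintype.expect_eq_sum_div_card, hN, one_le_div hpos]
  calc (q.choose ℓ : ℝ) ^ n ≤ a ^ (L + 1) - 1 := le_sub_iff_add_le.2 haL
    _ ≤ excess ρ a P Y := sub_le_sub_right (pow_le_pow_right₀ ha hY) 1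
    _ ≤ ∑ Z, excess ρ a P Z := single_le_sum (fun Z _ => excess_nonneg ha P Z) (mem_univ Y)

end Potential

section UniformLists

variable {ι α : Type*} [Fintype ι] [Fintype α] {ℓ : ℕ}

lemma nonempty_powersetCard_of_le_card (hℓ : ℓ ≤ Fintype.card α) :
    Nonempty (Set.powersetCard α ℓ) := by
  obtain ⟨s, -, hs⟩ := exists_subset_card_eq (s := (univ : Finset α)) hℓ
  exact ⟨⟨s, hs⟩⟩

variable [DecidableEq α]

lemma expect_mem_powersetCard (hℓ : ℓ ≤ Fintype.card α) (i : α) :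
    𝔼 s : Set.powersetCard α ℓ, (if i ∈ (s : Finset α) then 1 else 0 : ℝ) = ℓ / Fintype.card α := by
  have hsymm (j : α) : 𝔼 s : Set.powersetCard α ℓ, (if j ∈ (s : Finset α) then 1 else 0 : ℝ) =
      𝔼 s : Set.powersetCard α ℓ, (if i ∈ (s : Finset α) then 1 else 0 : ℝ) := by
    refine Fintype.expect_equiv (MulAction.toPerm (Equiv.swap j i)) _ _ fun s => ?_
    have h := smul_mem_smul_finset_iff (s := (s : Finset α)) (b := j) (Equiv.swap j i)
    rw [Equiv.Perm.smul_def (Equiv.swap j i) j, Equiv.swap_apply_left] at h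
    simp only [MulAction.toPerm_apply, Set.powersetCard.coe_smul, h]
  have hsum : ∑ j, 𝔼 s : Set.powersetCard α ℓ, (if j ∈ (s : Finset α) then 1 else 0 : ℝ) = ℓ := by
    have := nonempty_powersetCard_of_le_card hℓ
    rw [← expect_sum_comm]
    simp
  have hα : (Fintype.card α : ℝ) ≠ 0 := Nat.cast_ne_zero.2 (Fintype.card_pos_iff.2 ⟨i⟩).ne'
  rw [eq_div_iff hα, ← hsum, sum_congr rfl fun j _ => hsymm j, sum_const, card_univ, nsmul_eq_mul,
    mul_comm]

lemma expect_prod_pi {X : Type*} [Fintype X] [DecidableEq ι] (f : ι → X → ℝ) :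
    𝔼 x : ι → X, ∏ i, f i (x i) = ∏ i, 𝔼 y, f i y := by
  simp only [Fintype.expect_eq_sum_div_card, prod_div_distrib, Fintype.prod_sum]
  simp

lemma expect_pow_misses [DecidableEq ι] (hℓ : ℓ ≤ Fintype.card α) (x : ι → α) (t : ℝ) :
    𝔼 Z : ι → Set.powersetCard α ℓ, t ^ misses x Z =
      ((ℓ + (Fintype.card α - ℓ) * t) / Fintype.card α) ^ Fintype.card ι := by
  have hcoord (i : ι) : 𝔼 s : Set.powersetCard α ℓ, (if x i ∉ (s : Finset α) then t else 1) =
      (ℓ + (Fintype.card α - ℓ) * t) / Fintype.card α := by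
    have := nonempty_powersetCard_of_le_card hℓ
    have hα : (Fintype.card α : ℝ) ≠ 0 := Nat.cast_ne_zero.2 (Fintype.card_pos_iff.2 ⟨x i⟩).ne'
    have h (s : Set.powersetCard α ℓ) : (if x i ∉ (s : Finset α) then t else 1) =
        t + (1 - t) * if x i ∈ (s : Finset α) then 1 else 0 := by
      split_ifs <;> ring
    simp only [h, expect_add_distrib, ← mul_expect, expect_mem_powersetCard hℓ]
    rw [Fintype.expect_const]
    field_simp
    ring
  have hprod (Z : ι → Set.powersetCard α ℓ) :
      t ^ misses x Z = ∏ i, if x i ∉ (Z i : Finset α) then t else 1 := by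
    rw [misses, ← prod_const, prod_filter]
  simp only [hprod]
  rw [expect_prod_pi fun i (s : Set.powersetCard α ℓ) => if x i ∉ (s : Finset α) then t else 1]
  simp only [hcoord, prod_const, card_univ]

lemma rpow_mul_expect_misses_le_le [DecidableEq ι] {ρ t : ℝ} (hℓ : ℓ ≤ Fintype.card α)
    (ht : 0 ≤ t) (ht1 : t ≤ 1) (x : ι → α) :
    (t ^ ρ) ^ Fintype.card ι * 𝔼 Z : ι → Set.powersetCard α ℓ,
        (if (misses x Z : ℝ) ≤ ρ * Fintype.card ι then 1 else 0 : ℝ) ≤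
      ((ℓ + (Fintype.card α - ℓ) * t) / Fintype.card α) ^ Fintype.card ι := by
  rw [← expect_pow_misses hℓ x, mul_expect]
  refine expect_le_expect fun Z _ => ?_
  split_ifs with h
  · rw [mul_one, ← Real.rpow_mul_natCast ht, ← Real.rpow_natCast]
    exact Real.rpow_le_rpow_of_exponent_ge' ht ht1 (Nat.cast_nonneg _) h
  · rw [mul_zero]
    exact pow_nonneg ht _

end UniformLists

section Entropy

variable {q ℓ : ℕ} {ρ : ℝ}

/-- The parameter that optimises the exponential Markov inequality for the number of lists of
size `ℓ` missed by a fixed word. -/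
def tilt (q ℓ : ℕ) (ρ : ℝ) : ℝ := ρ * ℓ / ((1 - ρ) * (q - ℓ))

lemma lt_one_of_le_one_sub_div (hℓ : 0 < ℓ) (hq : 0 < q) (hρ : ρ ≤ 1 - (ℓ : ℝ) / q) : ρ < 1 := by
  have : (0 : ℝ) < ℓ / q := by positivity
  linarith

lemma tilt_nonneg (hℓq : ℓ < q) (hρ0 : 0 ≤ ρ) (hρ1 : ρ < 1) : 0 ≤ tilt q ℓ ρ := by
  have : 0 < 1 - ρ := sub_pos.2 hρ1
  have h2 : (0 : ℝ) < q - ℓ := sub_pos.2 (by exact_mod_cast hℓq)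
  rw [tilt]
  positivity

lemma tilt_le_one (hℓq : ℓ < q) (hρ1 : ρ < 1) (hρ : ρ ≤ 1 - (ℓ : ℝ) / q) : tilt q ℓ ρ ≤ 1 := by
  have : 0 < 1 - ρ := sub_pos.2 hρ1
  have h2 : (0 : ℝ) < q - ℓ := sub_pos.2 (by exact_mod_cast hℓq)
  have hq : (0 : ℝ) < q := by exact_mod_cast hℓq.pos
  rw [tilt, div_le_one (by positivity)]
  have h : (q : ℝ) * ρ ≤ q - ℓ := by
    calc (q : ℝ) * ρ ≤ q * (1 - ℓ / q) := by gcongr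
      _ = q - ℓ := by field_simp
  linarith

lemma add_mul_tilt (hℓq : ℓ < q) (hρ1 : ρ < 1) :
    ℓ + ((q : ℝ) - ℓ) * tilt q ℓ ρ = ℓ / (1 - ρ) := by
  have h1 : 1 - ρ ≠ 0 := (sub_pos.2 hρ1).ne'
  have h2 : (q : ℝ) - ℓ ≠ 0 := (sub_pos.2 (by exact_mod_cast hℓq)).ne'
  rw [tilt]
  field_simp
  ring

lemma tilt_rpow_pos (hℓ : 0 < ℓ) (hℓq : ℓ < q) (hρ0 : 0 ≤ ρ) (hρ1 : ρ < 1) :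
    0 < tilt q ℓ ρ ^ ρ := by
  have h1 : 0 < 1 - ρ := sub_pos.2 hρ1
  have h2 : (0 : ℝ) < q - ℓ := sub_pos.2 (by exact_mod_cast hℓq)
  rcases hρ0.eq_or_lt with rfl | hρ0
  · simp
  · rw [tilt]
    positivity

lemma tilt_rpow_mul_rpow_hStar (hℓ : 0 < ℓ) (hℓq : ℓ < q) (hρ0 : 0 ≤ ρ)
    (hρ : ρ ≤ 1 - (ℓ : ℝ) / q) :
    tilt q ℓ ρ ^ ρ * (q : ℝ) ^ hStar q ℓ ρ = ℓ / (1 - ρ) := by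
  have hℓ' : (0 : ℝ) < ℓ := by exact_mod_cast hℓ
  have hq : (0 : ℝ) < q := by exact_mod_cast hℓq.pos
  have hq1 : (q : ℝ) ≠ 1 := by exact_mod_cast (show q ≠ 1 by lia)
  have h1 : 0 < 1 - ρ := sub_pos.2 (lt_one_of_le_one_sub_div hℓ hℓq.pos hρ)
  have h2 : (0 : ℝ) < q - ℓ := sub_pos.2 (by exact_mod_cast hℓq)
  have hlog {x : ℝ} (hx : 0 < x) (s : ℝ) : (q : ℝ) ^ (s * Real.logb q x) = x ^ s := by
    rw [mul_comm, Real.rpow_mul hq.le, Real.rpow_logb hq hq1 hx]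
  rw [hStar, if_pos hρ, Real.rpow_add hq, hlog (div_pos hℓ' h1)]
  rcases hρ0.eq_or_lt with rfl | hρ0
  · simp
  calc tilt q ℓ ρ ^ ρ * ((q : ℝ) ^ (ρ * Real.logb q ((q - ℓ) / ρ)) * (ℓ / (1 - ρ)) ^ (1 - ρ))
      = (tilt q ℓ ρ * ((q - ℓ) / ρ)) ^ ρ * (ℓ / (1 - ρ)) ^ (1 - ρ) := by
        rw [hlog (div_pos h2 hρ0), ← mul_assoc, Real.mul_rpow _ (div_pos h2 hρ0).le]
        exact tilt_nonneg hℓq hρ0.le (sub_pos.1 h1)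
    _ = (ℓ / (1 - ρ)) ^ ρ * (ℓ / (1 - ρ)) ^ (1 - ρ) := by
        congr 2
        rw [tilt]
        field_simp
    _ = ℓ / (1 - ρ) := by
        rw [← Real.rpow_add (div_pos hℓ' h1), add_sub_cancel, Real.rpow_one]

lemma expect_misses_le_le {ι α : Type*} [Fintype ι] [DecidableEq ι] [Fintype α] [DecidableEq α]
    (hℓ : 0 < ℓ) (hℓα : ℓ < Fintype.card α) (hρ0 : 0 ≤ ρ) (hρ : ρ ≤ 1 - (ℓ : ℝ) / Fintype.card α)
    (x : ι → α) :
    𝔼 Z : ι → Set.powersetCard α ℓ,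
        (if (misses x Z : ℝ) ≤ ρ * Fintype.card ι then 1 else 0 : ℝ) ≤
      (Fintype.card α : ℝ) ^ ((hStar (Fintype.card α) ℓ ρ - 1) * Fintype.card ι) := by
  have hα : (0 : ℝ) < Fintype.card α := by exact_mod_cast hℓα.pos
  have hρ1 := lt_one_of_le_one_sub_div hℓ hℓα.pos hρ
  have h := rpow_mul_expect_misses_le_le (ρ := ρ) hℓα.le (tilt_nonneg hℓα hρ0 hρ1)
    (tilt_le_one hℓα hρ1 hρ) x
  rw [add_mul_tilt hℓα hρ1, ← tilt_rpow_mul_rpow_hStar hℓ hℓα hρ0 hρ, mul_div_assoc, mul_pow] at h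
  rw [Real.rpow_mul_natCast hα.le, Real.rpow_sub_one hα.ne']
  exact le_of_mul_le_mul_left h (pow_pos (tilt_rpow_pos hℓ hℓα hρ0 hρ1) _)

lemma potential_zero_le [NeZero q] {n : ℕ} {a : ℝ} (ha : 1 ≤ a) (hℓ : 0 < ℓ) (hℓq : ℓ < q)
    (hρ0 : 0 ≤ ρ) (hρ : ρ ≤ 1 - (ℓ : ℝ) / q) (P : PermMatrix q 0 n) :
    potential ℓ ρ a P ≤ a * (q : ℝ) ^ ((hStar q ℓ ρ - 1) * n) := by
  have h := expect_misses_le_le (ι := Fin n) (α := Fin q) hℓ (by simpa using hℓq) hρ0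
    (by simpa using hρ) (enc 0 P ![])
  simp only [Fintype.card_fin] at h
  refine le_trans ?_ (mul_le_mul_of_nonneg_left h (zero_le_one.trans ha))
  rw [mul_expect]
  refine expect_le_expect fun Z _ => ?_
  rw [excess, closeCount, card_filter, Fintype.sum_unique]
  by_cases hZ : (misses (enc 0 P ![]) Z : ℝ) ≤ ρ * n <;> simp [Subsingleton.elim default ![], hZ]

end Entropy

section Thresholds

variable {γ : ℝ} {k i : ℕ}

/-- After `i` of `k` rows the potential is compared with `1 / invThreshold γ k i ^ 2`. Without
deviations the potential doubles with each row, which accounts for the power of `√2`; the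
term `i / 4` makes room for the deviation allowed at each row. -/
def invThreshold (γ : ℝ) (k i : ℕ) : ℝ := √2 ^ (k - i) * (γ - i / 4)

lemma invThreshold_zero_sq : invThreshold γ k 0 ^ 2 = 2 ^ k * γ ^ 2 := by
  rw [invThreshold, mul_pow, ← pow_mul, mul_comm (k - 0), pow_mul, Real.sq_sqrt zero_le_two]
  simp

lemma one_lt_invThreshold (hk : 0 < k) (hγ : √2 * k < γ) (hi : i ≤ k) :
    1 < invThreshold γ k i := by
  have h2 : 5 / 4 < √2 := Real.lt_sqrt_of_sq_lt (by norm_num)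
  have hk' : (1 : ℝ) ≤ k := by exact_mod_cast hk
  have hi' : (i : ℝ) ≤ k := by exact_mod_cast hi
  have h : 1 < γ - i / 4 := by nlinarith
  exact one_lt_mul_of_le_of_lt (one_le_pow₀ (by linarith)) h

lemma mul_add_le_invThreshold (hi : i < k) :
    √2 * invThreshold γ k (i + 1) + 1 / 4 ≤ invThreshold γ k i := by
  have h : (1 : ℝ) ≤ √2 ^ (k - i) := one_le_pow₀ (Real.one_le_sqrt.2 one_le_two)
  have hpow : √2 ^ (k - i) = √2 * √2 ^ (k - (i + 1)) := by
    rw [← pow_succ']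
    congr 1
    lia
  rw [invThreshold, ← mul_assoc, ← hpow, invThreshold]
  push_cast
  linarith

lemma le_sqrt_two_mul_invThreshold (hγ : √2 * k < γ) (hi : i < k) :
    γ ≤ √2 * invThreshold γ k i := by
  have h2 : 5 / 4 < √2 := Real.lt_sqrt_of_sq_lt (by norm_num)
  have hi' : (i : ℝ) ≤ k := by exact_mod_cast hi.le
  have : (0 : ℝ) ≤ i := i.cast_nonneg
  have h : γ ≤ 2 * (γ - i / 4) := by nlinarith
  calc γ ≤ √2 ^ 2 * (γ - i / 4) := by rwa [Real.sq_sqrt zero_le_two]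
    _ ≤ √2 ^ (k - i + 1) * (γ - i / 4) := by
        have : 0 ≤ γ - i / 4 := by nlinarith
        gcongr
        · linarith
        · lia
    _ = √2 * invThreshold γ k i := by rw [invThreshold, pow_succ']; ring

lemma two_mul_inv_sq_add_inv_cube_le {u v : ℝ} (hv : 1 < v) (huv : √2 * v + 1 / 4 ≤ u) :
    2 * u⁻¹ ^ 2 + u⁻¹ ^ 3 ≤ v⁻¹ ^ 2 := by
  have h2 : 5 / 4 < √2 := Real.lt_sqrt_of_sq_lt (by norm_num)
  have hu : 1 < u := by nlinarith
  have hsq : 2 * v ^ 2 ≤ (u - 1 / 4) ^ 2 := by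
    calc 2 * v ^ 2 = (√2 * v) ^ 2 := by rw [mul_pow, Real.sq_sqrt zero_le_two]
      _ ≤ (u - 1 / 4) ^ 2 := by
        gcongr
        linarith
  calc 2 * u⁻¹ ^ 2 + u⁻¹ ^ 3 = (2 * u + 1) / u ^ 3 := by field_simp
    _ ≤ 1 / v ^ 2 := by
        rw [div_le_div_iff₀ (by positivity) (by positivity)]
        nlinarith
    _ = v⁻¹ ^ 2 := by rw [one_div, inv_pow]

end Thresholds

section DoublingProcess

variable {β : Type*} [Fintype β] {D : PMF β} {K : ℝ}

lemma prob_iid_succ_sq_lt_le {k : ℕ} {φ : (Fin k → β) → ℝ} {ψ : (Fin (k + 1) → β) → ℝ}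
    {c : (Fin k → β) → β → ℝ} {s t : ℝ} (hφ : ∀ P, 0 ≤ φ P) (hc : ∀ P g, 0 ≤ c P g)
    (hψ : ∀ P g, ψ (Fin.snoc P g) = 2 * φ P + c P g)
    (hcφ : ∀ P, expectation D (c P) ≤ K * φ P ^ 2) (hK : 0 ≤ K) (hs : 0 < s)
    (hst : 2 * s ^ 2 + s ^ 3 ≤ t ^ 2) :
    prob (iid (Fin (k + 1)) D) {P | t ^ 2 < ψ P} ≤
      prob (iid (Fin k) D) {P | s ^ 2 < φ P} + K * s := by
  rw [prob_iid_succ, prob_eq_expectation, ← expectation_const (iid (Fin k) D) (K * s),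
    ← expectation_add]
  refine expectation_mono _ fun P => ?_
  simp only [Set.mem_ofPred_eq]
  by_cases hP : s ^ 2 < φ P
  · rw [Set.indicator_of_mem (show P ∈ {P | s ^ 2 < φ P} from hP)]
    have := prob_nonneg D {g | t ^ 2 < ψ (Fin.snoc P g)}ᶜ
    rw [prob_compl] at this
    exact le_add_of_le_of_nonneg (sub_nonneg.1 this) (by positivity)
  rw [Set.indicator_of_notMem (show P ∉ {P | s ^ 2 < φ P} from hP), zero_add]
  rw [not_lt] at hP
  calc prob D {g | t ^ 2 < ψ (Fin.snoc P g)}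
      ≤ prob D {g | s ^ 3 < c P g} := prob_mono D fun g hg => by
        simp only [Set.mem_ofPred_eq, hψ] at hg ⊢
        linarith
    _ ≤ K * φ P ^ 2 / s ^ 3 :=
        (prob_lt_le_expectation_div D (hc P) (by positivity)).trans (by gcongr; exact hcφ P)
    _ ≤ K * (s ^ 2) ^ 2 / s ^ 3 := by
        have := hφ P
        gcongr
    _ = K * s := by field_simp

variable {φ : ∀ k, (Fin k → β) → ℝ} {c : ∀ k, (Fin k → β) → β → ℝ}
  (hφ : ∀ k P, 0 ≤ φ k P) (hc : ∀ k P g, 0 ≤ c k P g)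
  (hsucc : ∀ k P g, φ (k + 1) (Fin.snoc P g) = 2 * φ k P + c k P g)
  (hcφ : ∀ k P, expectation D (c k P) ≤ K * φ k P ^ 2) (hK : 0 ≤ K)

include hφ hc hsucc hcφ hK

lemma prob_sq_lt_le_sum {s : ℕ → ℝ} (h0 : ∀ P, φ 0 P ≤ s 0 ^ 2) (k : ℕ)
    (hs : ∀ i < k, 0 < s i) (hss : ∀ i < k, 2 * s i ^ 2 + s i ^ 3 ≤ s (i + 1) ^ 2) :
    prob (iid (Fin k) D) {P | s k ^ 2 < φ k P} ≤ K * ∑ i ∈ range k, s i := by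
  induction k with
  | zero =>
    have h : {P | s 0 ^ 2 < φ 0 P} = ∅ := Set.eq_empty_of_forall_notMem fun P => not_lt.2 (h0 P)
    rw [h]
    simp [prob]
  | succ k ih =>
    rw [sum_range_succ, mul_add]
    refine (prob_iid_succ_sq_lt_le (hφ k) (hc k) (hsucc k) (hcφ k) hK (hs k k.lt_succ_self)
      (hss k k.lt_succ_self)).trans ?_
    gcongr
    exact ih (fun i hi => hs i (hi.trans k.lt_succ_self))
      fun i hi => hss i (hi.trans k.lt_succ_self)

lemma one_sub_le_prob_lt_one {k : ℕ} {γ : ℝ} (hk : 0 < k) (hγ : √2 * k < γ)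
    (h0 : ∀ P, φ 0 P ≤ 1 / (2 ^ k * γ ^ 2)) :
    1 - K * (√2 * k / γ) ≤ prob (iid (Fin k) D) {P | φ k P < 1} := by
  have hpos (i) (hi : i ≤ k) := one_pos.trans (one_lt_invThreshold hk hγ hi)
  have hγ0 : 0 < γ := lt_of_le_of_lt (by positivity) hγ
  have hle (i) (hi : i < k) : (invThreshold γ k i)⁻¹ ≤ √2 / γ := by
    rw [inv_le_comm₀ (hpos i hi.le) (by positivity), inv_div,
      div_le_iff₀' (by positivity)]
    exact le_sqrt_two_mul_invThreshold hγ hi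
  have htail : prob (iid (Fin k) D) {P | (invThreshold γ k k)⁻¹ ^ 2 < φ k P} ≤
      K * (√2 * k / γ) := by
    refine (prob_sq_lt_le_sum hφ hc hsucc hcφ hK (s := fun i => (invThreshold γ k i)⁻¹) ?_ k
      (fun i hi => inv_pos.2 (hpos i hi.le)) fun i hi => two_mul_inv_sq_add_inv_cube_le
        (one_lt_invThreshold hk hγ hi) (mul_add_le_invThreshold hi)).trans ?_
    · simpa [inv_pow, invThreshold_zero_sq] using h0
    · refine mul_le_mul_of_nonneg_left ?_ hK
      calc ∑ i ∈ range k, (invThreshold γ k i)⁻¹ ≤ #(range k) • (√2 / γ) :=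
            sum_le_card_nsmul _ _ _ fun i hi => hle i (mem_range.1 hi)
        _ = √2 * k / γ := by rw [card_range, nsmul_eq_mul]; ring
  calc 1 - K * (√2 * k / γ)
      ≤ prob (iid (Fin k) D) {P | (invThreshold γ k k)⁻¹ ^ 2 < φ k P}ᶜ := by
        rw [prob_compl]
        linarith
    _ ≤ prob (iid (Fin k) D) {P | φ k P < 1} := by
        refine prob_mono _ fun P hP => ?_
        simp only [Set.mem_compl_iff, Set.mem_ofPred_eq, not_lt] at hP ⊢
        exact hP.trans_lt (pow_lt_one₀ (inv_pos.2 (hpos k le_rfl)).le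
          (inv_lt_one_of_one_lt₀ (one_lt_invThreshold hk hγ le_rfl)) two_ne_zero)

end DoublingProcess

section ListRecovery

variable {q ℓ L k n : ℕ} {ρ η δ R : ℝ}

lemma one_sub_le_prob_isListRecoverable_of_isSpread [NeZero q]
    {D : PMF (Equiv.Perm (Fin q))} {K a γ : ℝ}
    (hD : IsSpread K D (Set.powersetCard (Fin q) ℓ)) (hK : 0 ≤ K) (hℓ : 0 < ℓ) (hℓq : ℓ < q)
    (hρ0 : 0 ≤ ρ) (hρ : ρ ≤ 1 - (ℓ : ℝ) / q) (ha : 1 ≤ a)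
    (haL : (q.choose ℓ : ℝ) ^ n + 1 ≤ a ^ (L + 1)) (hk : 0 < k) (hγ : √2 * k < γ)
    (haγ : a * (q : ℝ) ^ ((hStar q ℓ ρ - 1) * n) ≤ 1 / (2 ^ k * γ ^ 2)) :
    1 - K ^ n * (√2 * k / γ) ≤ prob (randomAPCode D k n) {C | IsListRecoverable ρ ℓ L C} := by
  have hDn := hD.iid (Fin n)
  rw [Fintype.card_fin] at hDn
  rw [randomAPCode, prob_map, iidMatrix_eq_iid]
  refine (one_sub_le_prob_lt_one (φ := fun k P => potential (k := k) ℓ ρ a P)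
    (fun k P => expect_nonneg fun Z _ => excess_nonneg ha P Z)
    (fun k P g => expect_nonneg fun Z _ =>
      mul_nonneg (excess_nonneg ha P (g • Z)) (excess_nonneg ha P Z))
    (fun k P g => potential_snoc P g)
    (fun k P => hDn.expectation_expect_mul_le (excess_nonneg ha P)) (pow_nonneg hK n) hk hγ
    fun P => (potential_zero_le ha hℓ hℓq hρ0 hρ P).trans haγ).trans ?_
  exact prob_mono _ fun P hP => isListRecoverable_of_potential_lt_one hℓq.le ha haL hP

lemma isListRecoverable_of_card_le {C : Code q n} (hC : Multiset.card C ≤ L) :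
    IsListRecoverable ρ ℓ L C := fun _ hD hcard =>
  absurd (Multiset.card_le_card hD) (by lia)

lemma rpow_logb_add_inv_div_pow {b x : ℝ} (hb : 1 < b) (hx : 0 < x) (hn : n ≠ 0) :
    (b ^ ((Real.logb b x + 1 / n) / (L + 1) * n)) ^ (L + 1) = x ^ n * b := by
  have hb0 : 0 < b := one_pos.trans hb
  have hexp : (Real.logb b x + 1 / n) / (L + 1) * n * (L + 1 : ℕ) = Real.logb b x * n + 1 := by
    push_cast
    field_simp
  rw [← Real.rpow_mul_natCast hb0.le, hexp, Real.rpow_add_one hb0.ne',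
    Real.rpow_mul_natCast hb0.le, Real.rpow_logb hb0 hb.ne' hx]

lemma two_pow_eq_rpow (hq : 0 < q) (hk : (k : ℝ) = R * Real.logb 2 q * n) :
    (2 : ℝ) ^ k = (q : ℝ) ^ (R * n) := by
  rw [← Real.rpow_natCast, hk, mul_comm R, mul_assoc, Real.rpow_mul zero_le_two,
    Real.rpow_logb two_pos (by norm_num) (by exact_mod_cast hq)]

lemma one_add_pow_le {x : ℝ} (hx : 0 ≤ x) (hnx : n * x ≤ 1) : (1 + x) ^ n ≤ 1 + 2 * (n * x) := by
  have h0 : 0 ≤ n * x := by positivity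
  calc (1 + x) ^ n ≤ Real.exp x ^ n := by
        gcongr
        rw [add_comm]
        exact Real.add_one_le_exp x
    _ = 1 + (Real.exp (n * x) - 1) := by rw [Real.exp_nat_mul]; ring
    _ ≤ 1 + 2 * (n * x) := by
        gcongr
        have := Real.abs_exp_sub_one_le (x := n * x) (by rwa [abs_of_nonneg h0])
        rw [abs_of_nonneg h0] at this
        exact (le_abs_self _).trans this

lemma one_add_pow_mul_le {x ε : ℝ} (hx : 0 ≤ x) (hnx : n * x ≤ 1) (hε0 : 0 ≤ ε) (hε1 : ε ≤ 1) :
    (1 + x) ^ n * ε ≤ ε + 2 * (n * x) := by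
  calc (1 + x) ^ n * ε ≤ (1 + 2 * (n * x)) * ε := by
        gcongr
        exact one_add_pow_le hx hnx
    _ ≤ ε + 2 * (n * x) := by
        have : 2 * (n * x) * ε ≤ 2 * (n * x) := mul_le_of_le_one_right (by positivity) hε1
        linarith

lemma one_sub_le_prob_isListRecoverable_of_isNearIndependent [NeZero q]
    {D : PMF (Equiv.Perm (Fin q))} (hD : IsNearIndependent ℓ δ D) (hδ : 0 < δ) (hn : 0 < n)
    (hℓ : 0 < ℓ) (hℓq : ℓ < q) (hρ0 : 0 ≤ ρ) (hρ : ρ ≤ 1 - (ℓ : ℝ) / q)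
    (hR : R = 1 - hStar q ℓ ρ - (Real.logb q (q.choose ℓ) + 1 / n) / (L + 1) - η)
    (hkR : (k : ℝ) = R * Real.logb 2 q * n) (hk : 0 < k)
    (hγ : √2 * k < (q : ℝ) ^ (η * n / 2)) :
    1 - (1 + δ * q.choose ℓ) ^ n * (√2 * k / (q : ℝ) ^ (η * n / 2)) ≤
      prob (randomAPCode D k n) {C | IsListRecoverable ρ ℓ L C} := by
  have hq : (0 : ℝ) < q := by exact_mod_cast hℓq.pos
  have hq2 : (2 : ℝ) ≤ q := by exact_mod_cast (show 2 ≤ q by lia)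
  have hq1 : (1 : ℝ) < q := by linarith
  have hC : (1 : ℝ) ≤ q.choose ℓ := by exact_mod_cast Nat.choose_pos hℓq.le
  have hCn : (1 : ℝ) ≤ (q.choose ℓ : ℝ) ^ n := one_le_pow₀ hC
  set σ : ℝ := (Real.logb q (q.choose ℓ) + 1 / n) / (L + 1) with hσ
  have hσ0 : 0 ≤ σ := by
    have := Real.logb_nonneg hq1 hC
    positivity
  refine one_sub_le_prob_isListRecoverable_of_isSpread (a := (q : ℝ) ^ (σ * n)) hD.isSpread
    (by positivity) hℓ hℓq hρ0 hρ (Real.one_le_rpow hq1.le (by positivity)) ?_ hk hγ (le_of_eq ?_)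
  · rw [hσ, rpow_logb_add_inv_div_pow hq1 (by linarith) hn.ne']
    nlinarith
  · rw [two_pow_eq_rpow hℓq.pos hkR, ← Real.rpow_mul_natCast hq.le, ← Real.rpow_add hq,
      ← Real.rpow_add hq, one_div, ← Real.rpow_neg hq.le]
    congr 1
    rw [hR]
    push_cast
    ring

lemma sub_sub_le_prob_isListRecoverable [NeZero q] {D : PMF (Equiv.Perm (Fin q))}
    (hD : IsNearIndependent ℓ δ D) (hδ : 0 < δ) (hn : 0 < n) (hℓ : 0 < ℓ) (hℓq : ℓ < q)
    (hL : 0 < L) (hρ0 : 0 ≤ ρ) (hρ : ρ ≤ 1 - (ℓ : ℝ) / q)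
    (hR : R = 1 - hStar q ℓ ρ - (Real.logb q (q.choose ℓ) + 1 / n) / (L + 1) - η)
    (hkR : (k : ℝ) = R * Real.logb 2 q * n) :
    1 - √2 * k * (q : ℝ) ^ (-(η * n / 2)) - 2 * δ * n * k * (q : ℝ) ^ (4 * ℓ) ≤
      prob (randomAPCode D k n) {C | IsListRecoverable ρ ℓ L C} := by
  have hq : (0 : ℝ) < q := by exact_mod_cast hℓq.pos
  set γ : ℝ := (q : ℝ) ^ (η * n / 2) with hγ
  have hγ0 : 0 < γ := Real.rpow_pos_of_pos hq _
  rw [Real.rpow_neg hq.le, ← hγ, ← div_eq_mul_inv]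
  have hε0 : 0 ≤ √2 * k / γ := by positivity
  have hτ0 : 0 ≤ 2 * δ * n * k * (q : ℝ) ^ (4 * ℓ) := by positivity
  rcases k.eq_zero_or_pos with rfl | hk
  · rw [randomAPCode, prob_map, prob_eq_one_of_forall]
    · linarith
    · exact fun P => isListRecoverable_of_card_le (by rwa [card_apCode])
  have hk1 : (1 : ℝ) ≤ k := by exact_mod_cast hk
  rcases le_or_gt 1 (√2 * k / γ) with hε | hε
  · exact le_trans (by linarith) (prob_nonneg ..)
  rcases le_or_gt 1 (2 * δ * n * k * (q : ℝ) ^ (4 * ℓ)) with hτ | hτ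
  · exact le_trans (by linarith) (prob_nonneg ..)
  refine le_trans ?_ (one_sub_le_prob_isListRecoverable_of_isNearIndependent hD hδ hn hℓ hℓq hρ0 hρ
    hR hkR hk ((div_lt_one hγ0).1 hε))
  have hx : 2 * (n * (δ * q.choose ℓ)) ≤ 2 * δ * n * k * (q : ℝ) ^ (4 * ℓ) := by
    have hC : (q.choose ℓ : ℝ) ≤ (q : ℝ) ^ (4 * ℓ) := by
      exact_mod_cast (Nat.choose_le_pow q ℓ).trans (Nat.pow_le_pow_right hℓq.pos (by lia))
    calc 2 * (n * (δ * q.choose ℓ)) = 2 * δ * n * 1 * q.choose ℓ := by ring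
      _ ≤ 2 * δ * n * k * (q : ℝ) ^ (4 * ℓ) := by gcongr
  have := one_add_pow_mul_le (n := n) (x := δ * q.choose ℓ) (by positivity) (by linarith) hε0 hε.le
  linarith

end ListRecovery

end APCode

end

theorem theorem1_general {q ℓ L n k : ℕ} [NeZero q] {ρ η δ R : ℝ} (hn : 1 ≤ n) (hℓ : 1 ≤ ℓ)
    (hℓq : ℓ < q) (hL : 1 ≤ L) (hρ0 : 0 ≤ ρ) (hρ : ρ ≤ 1 - (ℓ : ℝ) / q) (hδ : 0 < δ)
    (hR : R = 1 - APCode.hStar q ℓ ρ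
      - (Real.logb q (Nat.choose q ℓ) + 1 / n) / (L + 1) - η)
    (hk : (k : ℝ) = R * Real.logb 2 q * n) :
    ∃ (b r : ℕ) (T : (Fin b → Bool) → Equiv.Perm (Fin q)),
      (b : ℝ) ≤ 2 * max 0 (ℓ * Real.logb 2 q + Real.logb 2 (1 / δ)) ∧
      APCode.IsNearIndependent ℓ δ (APCode.fromBits T) ∧
      APCode.UsesRandomBits (APCode.randomAPCode (APCode.fromBits T) k n) r ∧
      (r : ℝ) ≤ 2 * (n * k * max 0 (ℓ * Real.logb 2 q + Real.logb 2 (1 / δ))) ∧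
      (∀ C ∈ (APCode.randomAPCode (APCode.fromBits T) k n).support, APCode.rate C = R) ∧
      1 - Real.sqrt 2 * k * (q : ℝ) ^ (-(η * n / 2)) - 2 * δ * n * k * (q : ℝ) ^ (4 * ℓ)
        ≤ ((APCode.randomAPCode (APCode.fromBits T) k n).toOuterMeasure
            {C | APCode.IsListRecoverable ρ ℓ L C}).toReal := by
  obtain ⟨b, T, hb, hT⟩ := APCode.exists_isNearIndependent_le (m := ℓ) hℓq.pos hδ
  refine ⟨b, k * (n * b), T, hb, hT, APCode.usesRandomBits_randomAPCode ⟨T, rfl⟩ k n, ?_, ?_,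
    APCode.sub_sub_le_prob_isListRecoverable hT hδ hn hℓ hℓq hL hρ0 hρ hR hk⟩
  · calc ((k * (n * b) : ℕ) : ℝ) = n * k * b := by push_cast; ring
      _ ≤ n * k * (2 * max 0 (ℓ * Real.logb 2 q + Real.logb 2 (1 / δ))) := by gcongr
      _ = 2 * (n * k * max 0 (ℓ * Real.logb 2 q + Real.logb 2 (1 / δ))) := by ring
  · intro C hC
    obtain ⟨P, -, rfl⟩ := (PMF.mem_support_map_iff ..).1 hC
    exact APCode.rate_apCode (by lia) (by lia) hk P

theorem theorem1 :
    ∃ c A : ℝ, 0 < c ∧ 0 < A ∧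
      ∀ (q ℓ L n k : ℕ) [NeZero q] (ρ η δ R : ℝ),
        2 ≤ q → 1 ≤ n → 1 ≤ ℓ → ℓ < min q L →
        0 ≤ ρ → ρ ≤ 1 - (ℓ : ℝ) / q →
        2 * Real.logb q (2 * n / Real.log 2) / n ≤ η →
        0 < δ →
        R = 1 - APCode.hStar q ℓ ρ
              - (Real.logb q (Nat.choose q ℓ) + 1 / n) / (L + 1) - η →
        (k : ℝ) = R * Real.logb 2 q * n →
        -- a small near-independent family of permutations, indexed by `b`-bit strings
        ∃ (b r : ℕ) (T : (Fin b → Bool) → Equiv.Perm (Fin q)),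
          (b : ℝ) ≤ A * max 0 (ℓ * Real.logb 2 q + Real.logb 2 (1 / δ)) ∧
          APCode.IsNearIndependent ℓ δ (APCode.fromBits T) ∧
          -- the number of random bits used by the ensemble
          APCode.UsesRandomBits (APCode.randomAPCode (APCode.fromBits T) k n) r ∧
          (r : ℝ) ≤ A * (n * k * max 0 (ℓ * Real.logb 2 q + Real.logb 2 (1 / δ))) ∧
          -- the rate
          (∀ C ∈ (APCode.randomAPCode (APCode.fromBits T) k n).support,
            APCode.rate C = R) ∧
          -- list-recoverability with high probability
          1 - Real.sqrt 2 * k * (q : ℝ) ^ (-(η * n / 2)) - c * δ * n * k * (q : ℝ) ^ (4 * ℓ)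
            ≤ ((APCode.randomAPCode (APCode.fromBits T) k n).toOuterMeasure
                {C | APCode.IsListRecoverable ρ ℓ L C}).toReal :=
  ⟨2, 2, two_pos, two_pos, fun _ _ _ _ _ _ _ _ _ _ _ hn hℓ hℓqL hρ0 hρ _ hδ hR hk =>
    theorem1_general hn hℓ (lt_min_iff.1 hℓqL).1 (lt_min_iff.1 hℓqL).2.pos hρ0 hρ hδ hR hk⟩
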